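/- **Theorem 5.5** (topological origin, case $E^\theta\triangle E^{-\theta}$). Let $\gamma>0$ and $\theta\in\mathbb R$, and put $$\alpha=\frac{\gamma}{1-e^{-\gamma}}-\frac{\gamma}{1-e^{\gamma}}=\gamma\coth(\gamma/2),\qquad \eta=\frac{-\gamma}{1-e^{-\gamma}},\qquad \beta=\frac{\gamma}{1-e^{\gamma}}.$$ For $N\ge 1$ let $C^\gamma\in\mathbb R^{2N\times 2N}$ be the tridiagonal matrix with diagonal entries $C^\gamma_{11}=C^\gamma_{2N,2N}=\alpha+\beta$ and $C^\gamma_{ii}=\alpha$ for $1<i<2N$, and with off-diagonal entries $C^\gamma_{i,i-1}=\beta$, $C^\gamma_{i,i+1}=\eta$ in the rows $i\le N$ and $C^\gamma_{i,i-1}=\eta$, $C^\gamma_{i,i+1}=\beta$ in the rows $i\ge N+1$ (whenever the column index lies in $\{1,\dots,2N\}$). Let $\mathcal C^{\theta,\gamma}=V^\theta C^\gamma$, where $V^\theta$ is the diagonal matrix with $N$ entries $e^{\mathrm i\theta}$ followed by $N$ entries $e^{-\mathrm i\theta}$. Define on the unit circle the symbols $$f^\theta_{\pm}(e^{\mathrm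 i\phi})=e^{\pm\mathrm i\theta}\left(\beta e^{\pm\mathrm i\phi}+\alpha+\eta e^{\mp\mathrm i\phi}\right),$$ and let $$E^{\theta}=\{z\in\mathbb C:\operatorname{wind}(f^\theta_+,z)<0\},\qquad E^{-\theta}=\{z\in\mathbb C:-\operatorname{wind}(f^\theta_-,z)<0\},$$ where $\operatorname{wind}(f,z)$ is the winding number around $z$ of the closed curve $\phi\mapsto f(e^{\mathrm i\phi})$, $0\le\phi\le2\pi$ (points $z$ on the curve of $f^\theta_\pm$ are excluded from the corresponding set). Suppose that $\lambda\in E^\theta\triangle E^{-\theta}$. Then there exist $0<\rho<1$, constants $C_1,C_2,C_3>0$ and $N_0\in\mathbb N$, all independent of $N$, such that for every $N\ge N_0$ there is a nonzero vector $\boldsymbol v\in\mathbb C^{2N}$ with $$\frac{\lVert(\mathcal C^{\theta,\gamma}-\lambda)\boldsymbol v\rVert}{\lVert\boldsymbol v\rVert}\le\max(C_1,NC_2)\,\rho^{N-1}$$ (Euclidean norms) and $$\frac{|\boldsymbol v_j|}{\max_i|\boldsymbol v_i|}\le C_3N\rho^{j-1},\quad j=1,\dots,2N,\quad\text{if }\lambda\in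 E^\theta,$$ $$\frac{|\boldsymbol v_j|}{\max_i|\boldsymbol v_i|}\le C_3N\rho^{2N-j},\quad j=1,\dots,2N,\quad\text{if }\lambda\in E^{-\theta}.$$ -/

import Mathlib

open scoped Matrix symmDiff

noncomputable section

namespace GaugeCapacitance

/-- The diagonal coefficient `α = γ / (1 - e^{-γ}) - γ / (1 - e^{γ}) = γ coth (γ / 2)`. -/
def coeffAlpha (γ : ℝ) : ℝ := γ / (1 - Real.exp (-γ)) - γ / (1 - Real.exp γ)

/-- The off-diagonal coefficient `β = γ / (1 - e^{γ})`. -/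
def coeffBeta (γ : ℝ) : ℝ := γ / (1 - Real.exp γ)

/-- The off-diagonal coefficient `η = -γ / (1 - e^{-γ})`. -/
def coeffEta (γ : ℝ) : ℝ := -γ / (1 - Real.exp (-γ))

/-- The gauge capacitance matrix `C^γ`, a real tridiagonal `2N × 2N` matrix.
Indices are zero-based, so the rows `1, …, N` of the upper block are those with `i < N`.
The rows of the upper block read `(β, α, η)`, those of the lower block read `(η, α, β)`, and the
first and the last diagonal entries are `α + β`. -/
def gaugeMatrix (N : ℕ) (γ : ℝ) : Matrix (Fin (2 * N)) (Fin (2 * N)) ℝ :=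
  Matrix.of fun i j =>
    if (i : ℕ) = (j : ℕ) then
      if (i : ℕ) = 0 ∨ (i : ℕ) + 1 = 2 * N then coeffAlpha γ + coeffBeta γ else coeffAlpha γ
    else if (j : ℕ) = (i : ℕ) + 1 then
      if (i : ℕ) < N then coeffEta γ else coeffBeta γ
    else if (i : ℕ) = (j : ℕ) + 1 then
      if (i : ℕ) < N then coeffBeta γ else coeffEta γ
    else 0

/-- The diagonal matrix `V^θ` with `N` entries `e^{iθ}` followed by `N` entries `e^{-iθ}`. -/
def materialMatrix (N : ℕ) (θ : ℝ) : Matrix (Fin (2 * N)) (Fin (2 * N)) ℂ :=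
  Matrix.diagonal fun i =>
    if (i : ℕ) < N then Complex.exp (θ * Complex.I) else Complex.exp (-(θ * Complex.I))

/-- The generalised gauge capacitance matrix `C^{θ,γ} = V^θ C^γ`. -/
def genGaugeMatrix (N : ℕ) (θ γ : ℝ) : Matrix (Fin (2 * N)) (Fin (2 * N)) ℂ :=
  materialMatrix N θ * (gaugeMatrix N γ).map (fun x : ℝ => (x : ℂ))

/-- The upper symbol `e^{iφ} ↦ e^{iθ} (β e^{iφ} + α + η e^{-iφ})` on the unit circle. -/
def upperSymbol (θ γ : ℝ) (w : Circle) : ℂ :=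
  Complex.exp (θ * Complex.I) *
    (coeffBeta γ * (w : ℂ) + coeffAlpha γ + coeffEta γ * (w : ℂ)⁻¹)

/-- The lower symbol `e^{iφ} ↦ e^{-iθ} (β e^{-iφ} + α + η e^{iφ})` on the unit circle. -/
def lowerSymbol (θ γ : ℝ) (w : Circle) : ℂ :=
  Complex.exp (-(θ * Complex.I)) *
    (coeffBeta γ * (w : ℂ)⁻¹ + coeffAlpha γ + coeffEta γ * (w : ℂ))

/-- The integer `n` is the winding number around `z` of the closed curve `φ ↦ f (e^{iφ})`,
`0 ≤ φ ≤ 2π`: the curve avoids `z`, and `n` is `1 / (2πi)` times the integral of `dζ / (ζ - z)`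
along it. Intended for continuously differentiable `f`, as the two symbols above are. -/
def IsWindingNumber (f : Circle → ℂ) (z : ℂ) (n : ℤ) : Prop :=
  (∀ w : Circle, f w ≠ z) ∧
    (2 * Real.pi * Complex.I)⁻¹ *
      ∫ φ in (0 : ℝ)..(2 * Real.pi),
        deriv (fun t : ℝ => f (Circle.exp t)) φ / (f (Circle.exp φ) - z) = (n : ℂ)

/-- The upper region of topological convergence `E^θ = {z | wind(f_+^θ, z) < 0}`. -/
def upperRegion (θ γ : ℝ) : Set ℂ :=
  {z | ∃ n : ℤ, IsWindingNumber (upperSymbol θ γ) z n ∧ n < 0}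

/-- The lower region of topological convergence `E^{-θ} = {z | -wind(f_-^θ, z) < 0}`. -/
def lowerRegion (θ γ : ℝ) : Set ℂ :=
  {z | ∃ n : ℤ, IsWindingNumber (lowerSymbol θ γ) z n ∧ -n < 0}

/-- The relative residual `‖(A - lam) v‖ / ‖v‖` of a vector `v` (Euclidean norms). -/
def relResidual {ι : Type*} [Fintype ι] [DecidableEq ι] (A : Matrix ι ι ℂ) (lam : ℂ)
    (v : EuclideanSpace ℂ ι) : ℝ :=
  ‖(WithLp.toLp 2 ((A - lam • (1 : Matrix ι ι ℂ)) *ᵥ WithLp.ofLp v) : EuclideanSpace ℂ ι)‖ / ‖v‖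

end GaugeCapacitance

end

/-! After multiplication by `w`, a symbol minus `lam` is a quadratic, so by the argument principle
its winding number is the number of roots in the unit disc minus one. Membership in either region
therefore places both roots of `η x² + (α - μ) x + β` in the open disc, where `μ` is `lam` with the
phase of the block removed (`HasDecayingRoots`). Every solution of the block's recurrence then
decays, which leaves both initial values free to meet the boundary condition at the end of the
chain. Truncating such a solution at the interface spoils the eigenvalue equation only in the two
rows adjacent to it, where the entries are already of size `ρ ^ N` (`exists_left_quasimode`).
Reversing the chain swaps the blocks, so the lower region follows from the upper one. -/

namespace GaugeCapacitance

open Complex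

/-! ### Winding numbers and roots of the symbols -/

/-- The logarithmic derivative of `w ↦ w - r` along the unit circle integrates to `2πi` or `0`
according to the position of `r`. -/
lemma integral_unitCircle_logDeriv_sub {r : ℂ} (hr : ‖r‖ ≠ 1) :
    (∫ φ in (0 : ℝ)..(2 * Real.pi), cexp (φ * I) * I / (cexp (φ * I) - r)) =
      2 * Real.pi * I * (if ‖r‖ < 1 then 1 else 0) := by
  have h : (∮ w in C(0, 1), (w - r)⁻¹) =
      ∫ φ in (0 : ℝ)..(2 * Real.pi), cexp (φ * I) * I / (cexp (φ * I) - r) := by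
    simp only [circleIntegral, deriv_circleMap, circleMap, smul_eq_mul, div_eq_mul_inv]
    simp
  rw [← h]
  split_ifs with h1
  · rw [circleIntegral.integral_sub_inv_of_mem_ball (by simpa using h1), mul_one]
  · rw [mul_zero]
    have hne : ∀ w ∈ Metric.closedBall (0 : ℂ) 1, w - r ≠ 0 := by
      intro w hw h0
      rw [sub_eq_zero] at h0
      subst h0
      have : ‖w‖ ≤ 1 := by simpa using hw
      exact h1 (lt_of_le_of_ne this hr)
    refine Complex.circleIntegral_eq_zero_of_differentiable_on_off_countable zero_le_one
      Set.countable_empty ?_ ?_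
    · exact ContinuousOn.inv₀ (by fun_prop) hne
    · intro w hw
      exact DifferentiableAt.inv (by fun_prop)
        (hne w (Metric.ball_subset_closedBall hw.1))

/-- The argument principle for a symbol `w ↦ z + K (w - r₁) (w - r₂) / w` on the unit circle. -/
lemma IsWindingNumber.eq_of_factor {f : Circle → ℂ} {z K r₁ r₂ : ℂ} {n : ℤ}
    (hf : ∀ w : Circle, f w = z + K * ((w : ℂ) - r₁) * ((w : ℂ) - r₂) / w)
    (hn : IsWindingNumber f z n) :
    ‖r₁‖ ≠ 1 ∧ ‖r₂‖ ≠ 1 ∧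
      n = (if ‖r₁‖ < 1 then 1 else 0) + (if ‖r₂‖ < 1 then 1 else 0) - 1 := by
  obtain ⟨havoid, hint⟩ := hn
  have hK : K ≠ 0 := by
    rintro rfl
    exact havoid 1 (by simp [hf])
  have hcirc : ∀ {r : ℂ}, ‖r‖ = 1 → ∃ w : Circle, (w : ℂ) = r := fun {r} h =>
    ⟨⟨r, mem_sphere_zero_iff_norm.2 h⟩, rfl⟩
  have h1 : ‖r₁‖ ≠ 1 := fun h => by
    obtain ⟨w, hw⟩ := hcirc h
    exact havoid w (by simp [hf, hw])
  have h2 : ‖r₂‖ ≠ 1 := fun h => by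
    obtain ⟨w, hw⟩ := hcirc h
    exact havoid w (by simp [hf, hw])
  refine ⟨h1, h2, ?_⟩
  have hne : ∀ {r : ℂ}, ‖r‖ ≠ 1 → ∀ φ : ℝ, cexp (φ * I) - r ≠ 0 := by
    intro r hr φ h0
    rw [sub_eq_zero] at h0
    exact hr (by rw [← h0, norm_exp_ofReal_mul_I])
  have hderiv : ∀ φ : ℝ, deriv (fun t : ℝ => f (Circle.exp t)) φ / (f (Circle.exp φ) - z) =
      (cexp (φ * I) * I / (cexp (φ * I) - r₁) + cexp (φ * I) * I / (cexp (φ * I) - r₂)) - I := by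
    intro φ
    have hE : HasDerivAt (fun t : ℝ => cexp (t * I)) (cexp (φ * I) * I) φ := by
      have := ((hasDerivAt_id φ).ofReal_comp.mul_const I).cexp
      simpa using this
    have hD := (((hE.sub_const r₁).const_mul K).mul (hE.sub_const r₂)).div hE
      (Complex.exp_ne_zero _)
    have hD' := hD.const_add z
    have hfun : (fun t : ℝ => f (Circle.exp t)) = fun t : ℝ =>
        z + K * (cexp (t * I) - r₁) * (cexp (t * I) - r₂) / cexp (t * I) := by
      funext t
      rw [hf, Circle.coe_exp]
    have hfφ := congrFun hfun φ
    rw [hfun, hfφ]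
    have hd := hD'.deriv
    have e0 := Complex.exp_ne_zero (φ * I)
    have e1 := hne h1 φ
    have e2 := hne h2 φ
    refine (congrArg (· / _) hd).trans ?_
    rw [Pi.mul_apply, add_sub_cancel_left]
    field_simp
  simp only [hderiv] at hint
  have hcont : ∀ {r : ℂ}, ‖r‖ ≠ 1 →
      Continuous fun φ : ℝ => cexp (φ * I) * I / (cexp (φ * I) - r) := by
    intro r hr
    exact Continuous.div (by fun_prop) (by fun_prop) (hne hr)
  have hcont' : Continuous fun φ : ℝ =>
      cexp (φ * I) * I / (cexp (φ * I) - r₁) + cexp (φ * I) * I / (cexp (φ * I) - r₂) :=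
    (hcont h1).add (hcont h2)
  rw [intervalIntegral.integral_sub (hcont'.intervalIntegrable _ _)
      (continuous_const.intervalIntegrable _ _),
    intervalIntegral.integral_add ((hcont h1).intervalIntegrable _ _)
      ((hcont h2).intervalIntegrable _ _),
    integral_unitCircle_logDeriv_sub h1, integral_unitCircle_logDeriv_sub h2,
    intervalIntegral.integral_const] at hint
  have hpi : (2 * Real.pi * I : ℂ) ≠ 0 := Complex.two_pi_I_ne_zero
  have hI : ((2 * Real.pi - 0 : ℝ) • I : ℂ) = 2 * Real.pi * I := by
    simp
  rw [hI, ← mul_add, ← mul_sub_one, inv_mul_cancel_left₀ hpi] at hint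
  have : ((((if ‖r₁‖ < 1 then 1 else 0) + (if ‖r₂‖ < 1 then 1 else 0) - 1 : ℤ)) : ℂ) = (n : ℂ) := by
    rw [← hint]
    push_cast
    rfl
  exact_mod_cast this.symm

/-- Every complex quadratic with nonzero leading coefficient splits. -/
lemma exists_roots_quadratic {a : ℂ} (b c : ℂ) (ha : a ≠ 0) :
    ∃ r₁ r₂ : ℂ, b = -(a * (r₁ + r₂)) ∧ c = a * (r₁ * r₂) := by
  obtain ⟨s, hs⟩ := IsAlgClosed.exists_eq_mul_self (discrim a b c)
  refine ⟨(-b + s) / (2 * a), (-b - s) / (2 * a), ?_, ?_⟩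
  · field_simp
    ring
  · have : s ^ 2 = b ^ 2 - 4 * a * c := by rw [sq, ← hs, discrim]
    field_simp
    linear_combination this

lemma coeffBeta_ne_zero {γ : ℝ} (hγ : 0 < γ) : (coeffBeta γ : ℂ) ≠ 0 := by
  have : 1 - Real.exp γ ≠ 0 := by
    have := Real.one_lt_exp_iff.2 hγ
    linarith
  exact_mod_cast div_ne_zero hγ.ne' this

lemma coeffEta_ne_zero {γ : ℝ} (hγ : 0 < γ) : (coeffEta γ : ℂ) ≠ 0 := by
  have : 1 - Real.exp (-γ) ≠ 0 := by
    have := Real.exp_lt_one_iff.2 (neg_lt_zero.2 hγ)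
    linarith
  exact_mod_cast div_ne_zero (neg_ne_zero.2 hγ.ne') this

/-- The characteristic polynomial `η x² + (α - μ) x + β` has both its roots in the open unit
disc. -/
def HasDecayingRoots (γ : ℝ) (μ : ℂ) : Prop :=
  ∃ x₁ x₂ : ℂ, ‖x₁‖ < 1 ∧ ‖x₂‖ < 1 ∧ (coeffAlpha γ : ℂ) - μ = -(coeffEta γ * (x₁ + x₂)) ∧
    (coeffBeta γ : ℂ) = coeffEta γ * (x₁ * x₂)

/-- A negative winding number leaves no root in the disc. The quadratic of the upper symbol is the
characteristic polynomial with its coefficients reversed, so the inverses of its roots are the ones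
needed. -/
lemma hasDecayingRoots_of_mem_upperRegion {θ γ : ℝ} (hγ : 0 < γ) {lam : ℂ}
    (h : lam ∈ upperRegion θ γ) : HasDecayingRoots γ (cexp (-(θ * I)) * lam) := by
  obtain ⟨n, hn, hneg⟩ := h
  obtain ⟨r₁, r₂, hb, hc⟩ := exists_roots_quadratic
    ((coeffAlpha γ : ℂ) - cexp (-(θ * I)) * lam) (coeffEta γ : ℂ) (coeffBeta_ne_zero hγ)
  have hee : cexp (θ * I) * cexp (-(θ * I)) = 1 := by rw [← Complex.exp_add]; simp
  have key := hn.eq_of_factor (K := cexp (θ * I) * coeffBeta γ) (r₁ := r₁) (r₂ := r₂) (by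
    intro w
    have hw : (w : ℂ) ≠ 0 := Circle.coe_ne_zero w
    rw [upperSymbol, hc]
    field_simp
    linear_combination (cexp (θ * I) * w) * hb + (lam * w) * hee)
  obtain ⟨h1, h2, hcount⟩ := key
  have hη := coeffEta_ne_zero hγ
  have hr1 : r₁ ≠ 0 := by rintro rfl; simp [hc] at hη
  have hr2 : r₂ ≠ 0 := by rintro rfl; simp [hc] at hη
  have g1 : 1 < ‖r₁‖ := by
    refine lt_of_le_of_ne (not_lt.1 fun hlt => ?_) h1.symm
    rw [if_pos hlt] at hcount
    split_ifs at hcount <;> omega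
  have g2 : 1 < ‖r₂‖ := by
    refine lt_of_le_of_ne (not_lt.1 fun hlt => ?_) h2.symm
    rw [if_pos hlt] at hcount
    split_ifs at hcount <;> omega
  refine ⟨r₁⁻¹, r₂⁻¹, ?_, ?_, ?_, ?_⟩
  · rw [norm_inv]; exact inv_lt_one_of_one_lt₀ g1
  · rw [norm_inv]; exact inv_lt_one_of_one_lt₀ g2
  · rw [hb, hc]; field_simp; ring
  · rw [hc]; field_simp

/-- Here the quadratic of the symbol is the characteristic polynomial itself, and a positive winding
number forces both roots into the disc. -/
lemma hasDecayingRoots_of_mem_lowerRegion {θ γ : ℝ} (hγ : 0 < γ) {lam : ℂ}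
    (h : lam ∈ lowerRegion θ γ) : HasDecayingRoots γ (cexp (θ * I) * lam) := by
  obtain ⟨n, hn, hneg⟩ := h
  obtain ⟨r₁, r₂, hb, hc⟩ := exists_roots_quadratic
    ((coeffAlpha γ : ℂ) - cexp (θ * I) * lam) (coeffBeta γ : ℂ) (coeffEta_ne_zero hγ)
  have hee : cexp (θ * I) * cexp (-(θ * I)) = 1 := by rw [← Complex.exp_add]; simp
  obtain ⟨-, -, hcount⟩ := hn.eq_of_factor (K := cexp (-(θ * I)) * coeffEta γ)
    (r₁ := r₁) (r₂ := r₂) (by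
      intro w
      have hw : (w : ℂ) ≠ 0 := Circle.coe_ne_zero w
      rw [lowerSymbol, hc]
      field_simp
      linear_combination (cexp (-(θ * I)) * w) * hb + (lam * w) * hee)
  refine ⟨r₁, r₂, ?_, ?_, hb, hc⟩
  · by_contra hlt
    rw [if_neg hlt] at hcount
    split_ifs at hcount <;> omega
  · by_contra hlt
    rw [if_neg hlt] at hcount
    split_ifs at hcount <;> omega

/-! ### Decaying solutions and the left quasi-mode -/

/-- A two-term linear recurrence whose characteristic roots lie in the open unit disc has
exponentially decaying solutions. -/
lemma exists_decaying_solution {x₁ x₂ : ℂ} (h1 : ‖x₁‖ < 1) (h2 : ‖x₂‖ < 1) :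
    ∃ (ρ C : ℝ) (u : ℕ → ℂ), 0 < ρ ∧ ρ < 1 ∧ 0 < C ∧ u 0 = 1 ∧ u 1 = 1 ∧
      (∀ k, u (k + 2) = (x₁ + x₂) * u (k + 1) - x₁ * x₂ * u k) ∧ ∀ k, ‖u k‖ ≤ C * ρ ^ k := by
  -- A rate strictly above both moduli absorbs the linear factor in `k` that a double root produces.
  obtain ⟨ρ, hρ, hρ1⟩ := exists_between (max_lt h1 h2)
  have hx1 : ‖x₁‖ < ρ := (le_max_left _ _).trans_lt hρ
  have hx2 : ‖x₂‖ < ρ := (le_max_right _ _).trans_lt hρ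
  have hρ0 : 0 < ρ := (norm_nonneg _).trans_lt hx1
  let p : ℕ → ℂ × ℂ :=
    fun k => (fun q : ℂ × ℂ => (q.2, (x₁ + x₂) * q.2 - x₁ * x₂ * q.1))^[k] (1, 1)
  have hp : ∀ k, p (k + 1) = ((p k).2, (x₁ + x₂) * (p k).2 - x₁ * x₂ * (p k).1) :=
    fun k => Function.iterate_succ_apply' _ _ _
  have hrec : ∀ k, (p (k + 2)).1 = (x₁ + x₂) * (p (k + 1)).1 - x₁ * x₂ * (p k).1 := by
    intro k
    rw [hp (k + 1), hp k]
  -- The difference `u (k + 1) - x₁ * u k` is geometric of ratio `x₂`, so `x₁ = x₂` needs no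
  -- separate case.
  have hdiff : ∀ k, ‖(p (k + 1)).1 - x₁ * (p k).1‖ ≤ ‖1 - x₁‖ * ρ ^ k := by
    intro k
    induction k with
    | zero => simp [hp, p]
    | succ k ih =>
      have : (p (k + 1 + 1)).1 - x₁ * (p (k + 1)).1 = x₂ * ((p (k + 1)).1 - x₁ * (p k).1) := by
        rw [hrec]; ring
      rw [this, norm_mul, pow_succ']
      calc ‖x₂‖ * _ ≤ ρ * (‖1 - x₁‖ * ρ ^ k) := by gcongr
        _ = _ := by ring
  have hgap : 0 < ρ - ‖x₁‖ := sub_pos.2 hx1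
  -- The constant is at least `1` for `k = 0`, and the induction step needs `‖1 - x₁‖ ≤ C * (ρ -
  -- ‖x₁‖)`.
  refine ⟨ρ, 1 + ‖1 - x₁‖ / (ρ - ‖x₁‖), fun k => (p k).1, hρ0, hρ1, by positivity,
    rfl, rfl, hrec, fun k => ?_⟩
  induction k with
  | zero =>
    have : 0 ≤ ‖1 - x₁‖ / (ρ - ‖x₁‖) := by positivity
    simpa [p] using this
  | succ k ih =>
    have hC : ‖1 - x₁‖ ≤ (1 + ‖1 - x₁‖ / (ρ - ‖x₁‖)) * (ρ - ‖x₁‖) := by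
      rw [add_mul, div_mul_cancel₀ _ hgap.ne']
      linarith
    set C := 1 + ‖1 - x₁‖ / (ρ - ‖x₁‖)
    calc ‖(p (k + 1)).1‖ = ‖((p (k + 1)).1 - x₁ * (p k).1) + x₁ * (p k).1‖ := by
          rw [sub_add_cancel]
      _ ≤ ‖1 - x₁‖ * ρ ^ k + ‖x₁‖ * (C * ρ ^ k) := by
          refine (norm_add_le _ _).trans (add_le_add (hdiff k) ?_)
          rw [norm_mul]
          gcongr
      _ ≤ C * (ρ - ‖x₁‖) * ρ ^ k + ‖x₁‖ * (C * ρ ^ k) := by gcongr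
      _ = C * ρ ^ (k + 1) := by ring

/-- The action of the gauge capacitance matrix on a sequence supported in the upper block. -/
lemma sum_gaugeMatrix_mul {N : ℕ} (hN : 1 ≤ N) (γ : ℝ) (w : ℕ → ℂ) (hw : ∀ k, N ≤ k → w k = 0)
    (i : Fin (2 * N)) :
    ∑ j : Fin (2 * N), (gaugeMatrix N γ i j : ℂ) * w j =
      (if (i : ℕ) = 0 then (coeffAlpha γ : ℂ) + coeffBeta γ else coeffAlpha γ) * w i +
        coeffEta γ * w (i + 1) +
        (if (i : ℕ) = 0 then 0 else
          (if (i : ℕ) < N then (coeffBeta γ : ℂ) else coeffEta γ) * w (i - 1)) := by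
  obtain ⟨i, hi⟩ := i
  simp only [gaugeMatrix, Matrix.of_apply]
  rw [Fin.sum_univ_eq_sum_range (fun j => (((if i = j then
      if i = 0 ∨ i + 1 = 2 * N then coeffAlpha γ + coeffBeta γ else coeffAlpha γ
    else if j = i + 1 then if i < N then coeffEta γ else coeffBeta γ
    else if i = j + 1 then if i < N then coeffBeta γ else coeffEta γ
    else 0 : ℝ)) : ℂ) * w j) (2 * N)]
  have hterm : ∀ j ∈ Finset.range (2 * N), (((if i = j then
      if i = 0 ∨ i + 1 = 2 * N then coeffAlpha γ + coeffBeta γ else coeffAlpha γ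
    else if j = i + 1 then if i < N then coeffEta γ else coeffBeta γ
    else if i = j + 1 then if i < N then coeffBeta γ else coeffEta γ
    else 0 : ℝ)) : ℂ) * w j =
      ((if j = i then
          (if i = 0 then (coeffAlpha γ : ℂ) + coeffBeta γ else coeffAlpha γ) * w j else 0) +
        (if j = i + 1 then (coeffEta γ : ℂ) * w j else 0)) +
        (if j = i - 1 then (if i = 0 then 0 else
          (if i < N then (coeffBeta γ : ℂ) else coeffEta γ) * w j) else 0) := by
    intro j _
    -- Only columns `j < N` contribute; they never meet the last corner, nor the superdiagonal of
    -- the lower block.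
    rcases Nat.lt_or_ge j N with hj | hj
    · split_ifs <;> first | (exfalso; omega) | (push_cast; ring)
    · rw [hw j hj]
      simp
  rw [Finset.sum_congr rfl hterm]
  simp only [Finset.sum_add_distrib, Finset.sum_ite_eq', Finset.mem_range]
  have h1 : i - 1 < 2 * N := by omega
  rw [if_pos hi, if_pos h1]
  congr 2
  split_ifs with h
  · rfl
  · rw [hw (i + 1) (by omega), mul_zero]

/-- `(A - lam) v` in coordinates for `A` the generalised gauge capacitance matrix. -/
lemma genGaugeMatrix_sub_mulVec (N : ℕ) (θ γ : ℝ) (lam : ℂ) (v : Fin (2 * N) → ℂ)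
    (i : Fin (2 * N)) :
    ((genGaugeMatrix N θ γ - lam • (1 : Matrix _ _ ℂ)) *ᵥ v) i =
      (if (i : ℕ) < N then cexp (θ * I) else cexp (-(θ * I))) *
        (∑ j, (gaugeMatrix N γ i j : ℂ) * v j) - lam * v i := by
  rw [Matrix.sub_mulVec, Matrix.smul_mulVec, Matrix.one_mulVec, Pi.sub_apply, Pi.smul_apply,
    smul_eq_mul, genGaugeMatrix, materialMatrix, ← Matrix.mulVec_mulVec, Matrix.mulVec_diagonal]
  rfl

/-- A boundary-adapted solution of the recurrence, truncated to the upper block, is a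
quasi-mode localised at the left end. -/
lemma exists_left_quasimode {θ γ : ℝ} {lam : ℂ}
    (h : HasDecayingRoots γ (cexp (-(θ * I)) * lam)) :
    ∃ ρ C : ℝ, 0 < ρ ∧ ρ < 1 ∧ 0 < C ∧ ∀ N : ℕ, 1 ≤ N →
      ∃ v : EuclideanSpace ℂ (Fin (2 * N)), v ≠ 0 ∧
        relResidual (genGaugeMatrix N θ γ) lam v ≤ C * ρ ^ (N - 1) ∧
        ∀ j : Fin (2 * N), ‖v j‖ / (⨆ i, ‖v i‖) ≤ C * ρ ^ (j : ℕ) := by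
  obtain ⟨x₁, x₂, h1, h2, hb, hc⟩ := h
  obtain ⟨ρ, C, u, hρ0, hρ1, hC, hu0, hu1, hrec, hdecay⟩ := exists_decaying_solution h1 h2
  set η : ℂ := (coeffEta γ : ℂ) with hη
  have hee : cexp (θ * I) * cexp (-(θ * I)) = 1 := by rw [← Complex.exp_add]; simp
  have hne : ‖cexp (θ * I)‖ = 1 := norm_exp_ofReal_mul_I θ
  have hne' : ‖cexp (-(θ * I))‖ = 1 := by
    have := norm_exp_ofReal_mul_I (-θ)
    simpa using this
  have hrow : ∀ k, (coeffBeta γ : ℂ) * u k +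
      ((coeffAlpha γ : ℂ) - cexp (-(θ * I)) * lam) * u (k + 1) + η * u (k + 2) = 0 := by
    intro k
    rw [hrec, hb, hc]
    ring
  -- `C` bounds the entries; each of the two residual rows contributes `‖η‖ * C`.
  refine ⟨ρ, C + 2 * (‖η‖ * C), hρ0, hρ1, by positivity, fun N hN => ?_⟩
  -- Entry `k` is `u (k + 1)`; `u 0` is a ghost value to the left of the chain, and `u 0 = u 1`
  -- turns the corner entry `α + β` into an ordinary row.
  let w : ℕ → ℂ := fun k => if k < N then u (k + 1) else 0
  have hwz : ∀ k, N ≤ k → w k = 0 := fun k hk => if_neg (not_lt.2 hk)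
  have hwp : ∀ k, k < N → w k = u (k + 1) := fun k hk => if_pos hk
  let v : EuclideanSpace ℂ (Fin (2 * N)) := WithLp.toLp 2 fun j => w j
  let i0 : Fin (2 * N) := ⟨0, by omega⟩
  have hv0 : ‖v i0‖ = 1 := by
    change ‖w 0‖ = 1
    rw [hwp 0 hN, zero_add, hu1, norm_one]
  have hvne : v ≠ 0 := by
    intro h0
    simp [h0] at hv0
  have hvnorm : 1 ≤ ‖v‖ := hv0 ▸ PiLp.norm_apply_le v i0
  have hsup : 1 ≤ ⨆ i, ‖v i‖ :=
    hv0 ▸ le_ciSup (f := fun i => ‖v i‖) (Set.finite_range _).bddAbove i0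
  have hstep : ∀ k : ℕ, C * ρ ^ (k + 1) ≤ C * ρ ^ k := fun k =>
    mul_le_mul_of_nonneg_left (pow_le_pow_of_le_one hρ0.le hρ1.le k.le_succ) hC.le
  refine ⟨v, hvne, ?_, fun j => ?_⟩
  · obtain ⟨M, rfl⟩ : ∃ M, N = M + 1 := ⟨N - 1, by omega⟩
    -- Row `M` lacks the truncated term `η * u (M + 2)`; row `M + 1` sees the last nonzero entry `u
    -- (M + 1)`.
    have hres : ∀ i : Fin (2 * (M + 1)),
        ((genGaugeMatrix (M + 1) θ γ - lam • (1 : Matrix _ _ ℂ)) *ᵥ WithLp.ofLp v) i =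
          (Pi.single (⟨M, by omega⟩ : Fin (2 * (M + 1))) (-(cexp (θ * I) * η * u (M + 2))) +
            Pi.single (⟨M + 1, by omega⟩ : Fin (2 * (M + 1)))
              (cexp (-(θ * I)) * η * u (M + 1)) : Fin (2 * (M + 1)) → ℂ) i := by
      intro i
      rw [genGaugeMatrix_sub_mulVec]
      change _ * (∑ j, (gaugeMatrix (M + 1) γ i j : ℂ) * w j) - lam * w i = _
      rw [sum_gaugeMatrix_mul hN γ w hwz i]
      obtain ⟨i, hi⟩ := i
      simp only [Pi.add_apply, Pi.single_apply, Fin.mk.injEq, ← hη]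
      rcases lt_trichotomy i (M + 1) with hlt | rfl | hgt
      · have hsum : ((if i = 0 then (coeffAlpha γ : ℂ) + coeffBeta γ else coeffAlpha γ) * w i +
            (if i = 0 then 0 else
              (if i < M + 1 then (coeffBeta γ : ℂ) else η) * w (i - 1))) =
            coeffAlpha γ * u (i + 1) + coeffBeta γ * u i := by
          rcases i with _ | i
          · simp [hwp 0 hlt, hu0, hu1]
          · simp [hwp _ hlt, hlt, hwp i (by omega)]
        rw [if_pos hlt, add_right_comm, hsum, if_neg hlt.ne, hwp i hlt]
        rcases eq_or_ne i M with rfl | hiM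
        · rw [hwz _ le_rfl, if_pos rfl]
          linear_combination cexp (θ * I) * hrow i + lam * u (i + 1) * hee
        · rw [hwp (i + 1) (by omega), if_neg hiM]
          linear_combination cexp (θ * I) * hrow i + lam * u (i + 1) * hee
      · simp [hwz, hwp M (Nat.lt_succ_self M)]
        ring
      · have e1 : i ≠ M := by omega
        have e2 : i ≠ M + 1 := by omega
        have e3 : i ≠ 0 := by omega
        simp [hwz i hgt.le, hwz (i + 1) (by omega), hwz (i - 1) (by omega), e1, e2]
    have hvec := congrArg (WithLp.toLp 2) (funext hres)
    rw [relResidual, hvec, WithLp.toLp_add]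
    refine (div_le_self (norm_nonneg _) hvnorm).trans ((norm_add_le _ _).trans ?_)
    change ‖PiLp.single 2 _ _‖ + ‖PiLp.single 2 _ _‖ ≤ _
    rw [PiLp.norm_single, PiLp.norm_single, norm_neg, norm_mul, norm_mul,
      norm_mul, norm_mul, hne, hne', one_mul, Nat.add_sub_cancel]
    have b1 : ‖η‖ * ‖u (M + 2)‖ ≤ ‖η‖ * (C * ρ ^ M) := by
      gcongr
      exact (hdecay _).trans ((hstep _).trans (hstep _))
    have b2 : ‖η‖ * ‖u (M + 1)‖ ≤ ‖η‖ * (C * ρ ^ M) := by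
      gcongr
      exact (hdecay _).trans (hstep _)
    have b3 : 0 ≤ C * ρ ^ M := by positivity
    linarith
  · refine (div_le_self (norm_nonneg _) hsup).trans ?_
    have hwj : ‖w j‖ ≤ C * ρ ^ (j : ℕ) := by
      rcases lt_or_ge (j : ℕ) N with hj | hj
      · rw [hwp _ hj]
        exact (hdecay _).trans (hstep _)
      · rw [hwz _ hj, norm_zero]
        positivity
    refine hwj.trans ?_
    gcongr
    have : 0 ≤ 2 * (‖η‖ * C) := by positivity
    linarith

/-! ### Reflection and the right quasi-mode -/

/-- Reversing the order of the resonators exchanges the two blocks. -/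
lemma genGaugeMatrix_submatrix_rev (N : ℕ) (θ γ : ℝ) :
    (genGaugeMatrix N (-θ) γ).submatrix Fin.revPerm Fin.revPerm = genGaugeMatrix N θ γ := by
  ext i j
  obtain ⟨i, hi⟩ := i
  obtain ⟨j, hj⟩ := j
  simp only [genGaugeMatrix, materialMatrix, Matrix.submatrix_apply, Matrix.diagonal_mul,
    Matrix.map_apply, gaugeMatrix, Matrix.of_apply, Fin.revPerm_apply, Fin.val_rev]
  have e1 : 2 * N - (i + 1) < N ↔ ¬ i < N := by omega
  have e2 : 2 * N - (i + 1) = 2 * N - (j + 1) ↔ i = j := by omega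
  have e3 : 2 * N - (j + 1) = 2 * N - (i + 1) + 1 ↔ i = j + 1 := by omega
  have e4 : 2 * N - (i + 1) = 2 * N - (j + 1) + 1 ↔ j = i + 1 := by omega
  have e5 : (2 * N - (i + 1) = 0 ∨ 2 * N - (i + 1) + 1 = 2 * N) ↔ (i = 0 ∨ i + 1 = 2 * N) := by
    omega
  simp only [e1, e2, e3, e4, e5]
  congr 1
  · split_ifs <;> simp
  · by_cases h1 : i = j
    · simp [h1]
    · by_cases h2 : i = j + 1
      · have h3 : j ≠ i + 1 := by omega
        simp only [if_neg h1, if_pos h2, if_neg h3, ite_not]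
      · simp only [if_neg h1, if_neg h2, ite_not]

lemma norm_toLp_comp_perm {ι : Type*} [Fintype ι] (e : Equiv.Perm ι) (f : ι → ℂ) :
    ‖(WithLp.toLp 2 (f ∘ e) : EuclideanSpace ℂ ι)‖ = ‖(WithLp.toLp 2 f : EuclideanSpace ℂ ι)‖ := by
  rw [EuclideanSpace.norm_eq, EuclideanSpace.norm_eq]
  congr 1
  exact Equiv.sum_comp e fun i => ‖f i‖ ^ 2

lemma relResidual_submatrix {ι : Type*} [Fintype ι] [DecidableEq ι] (A : Matrix ι ι ℂ) (lam : ℂ)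
    (e : Equiv.Perm ι) (v : EuclideanSpace ℂ ι) :
    relResidual (A.submatrix e e) lam (WithLp.toLp 2 (WithLp.ofLp v ∘ e)) =
      relResidual A lam v := by
  have h : A.submatrix e e - lam • (1 : Matrix ι ι ℂ) =
      (A - lam • (1 : Matrix ι ι ℂ)).submatrix e e := by
    rw [Matrix.submatrix_sub, Matrix.submatrix_smul, Pi.sub_apply, Pi.sub_apply,
      Pi.smul_apply, Pi.smul_apply, Matrix.submatrix_one_equiv]
  have hv : (WithLp.ofLp v ∘ e) ∘ e.symm = WithLp.ofLp v := by
    ext i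
    simp
  rw [relResidual, relResidual, h, Matrix.submatrix_mulVec_equiv, hv, norm_toLp_comp_perm,
    norm_toLp_comp_perm]

/-- The mirror image of `exists_left_quasimode`. -/
lemma exists_right_quasimode {θ γ : ℝ} {lam : ℂ}
    (h : HasDecayingRoots γ (cexp (θ * I) * lam)) :
    ∃ ρ C : ℝ, 0 < ρ ∧ ρ < 1 ∧ 0 < C ∧ ∀ N : ℕ, 1 ≤ N →
      ∃ v : EuclideanSpace ℂ (Fin (2 * N)), v ≠ 0 ∧
        relResidual (genGaugeMatrix N θ γ) lam v ≤ C * ρ ^ (N - 1) ∧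
        ∀ j : Fin (2 * N), ‖v j‖ / (⨆ i, ‖v i‖) ≤ C * ρ ^ (2 * N - 1 - (j : ℕ)) := by
  obtain ⟨ρ, C, hρ0, hρ1, hC, H⟩ := exists_left_quasimode (θ := -θ) (lam := lam)
    (by simpa using h)
  refine ⟨ρ, C, hρ0, hρ1, hC, fun N hN => ?_⟩
  obtain ⟨v, hv, hres, hdec⟩ := H N hN
  refine ⟨WithLp.toLp 2 (WithLp.ofLp v ∘ Fin.revPerm), ?_, ?_, fun j => ?_⟩
  · rw [← norm_ne_zero_iff, norm_toLp_comp_perm]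
    exact norm_ne_zero_iff.2 hv
  · rwa [← genGaugeMatrix_submatrix_rev, relResidual_submatrix]
  · have hj := hdec (Fin.rev j)
    have hs : (⨆ i, ‖(WithLp.toLp 2 (WithLp.ofLp v ∘ Fin.revPerm) :
        EuclideanSpace ℂ (Fin (2 * N))) i‖) = ⨆ i, ‖v i‖ :=
      Equiv.iSup_comp (g := fun i => ‖v i‖) Fin.revPerm
    have he : 2 * N - 1 - (j : ℕ) = ((Fin.rev j : Fin (2 * N)) : ℕ) := by
      rw [Fin.val_rev]
      omega
    rw [hs, he]
    exact hj

end GaugeCapacitance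

theorem theorem5p5 (θ γ : ℝ) (hγ : 0 < γ) (lam : ℂ)
    (hlam : lam ∈ GaugeCapacitance.upperRegion θ γ ∆ GaugeCapacitance.lowerRegion θ γ) :
    ∃ ρ : ℝ, 0 < ρ ∧ ρ < 1 ∧
    ∃ C₁ C₂ C₃ : ℝ, 0 < C₁ ∧ 0 < C₂ ∧ 0 < C₃ ∧
    ∃ N₀ : ℕ, ∀ N : ℕ, N₀ ≤ N →
      ∃ v : EuclideanSpace ℂ (Fin (2 * N)), v ≠ 0 ∧
        GaugeCapacitance.relResidual (GaugeCapacitance.genGaugeMatrix N θ γ) lam v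
          ≤ max C₁ (N * C₂) * ρ ^ (N - 1) ∧
        (lam ∈ GaugeCapacitance.upperRegion θ γ →
          ∀ j : Fin (2 * N), ‖v j‖ / (⨆ i, ‖v i‖) ≤ C₃ * N * ρ ^ (j : ℕ)) ∧
        (lam ∈ GaugeCapacitance.lowerRegion θ γ →
          ∀ j : Fin (2 * N), ‖v j‖ / (⨆ i, ‖v i‖) ≤ C₃ * N * ρ ^ (2 * N - 1 - (j : ℕ))) := by
  -- The quasi-mode bounds carry no factor `N`; for `N ≥ 1` that factor only weakens them.
  have hscale : ∀ {C : ℝ} {N : ℕ}, 0 < C → 1 ≤ N → C ≤ C * N := fun hC hN =>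
    le_mul_of_one_le_right hC.le (by exact_mod_cast hN)
  -- As `lam` lies in exactly one region, the localisation claim at the opposite end is vacuous.
  rcases hlam with ⟨hup, hnot⟩ | ⟨hlow, hnot⟩
  · obtain ⟨ρ, C, hρ0, hρ1, hC, H⟩ := GaugeCapacitance.exists_left_quasimode
      (GaugeCapacitance.hasDecayingRoots_of_mem_upperRegion hγ hup)
    refine ⟨ρ, hρ0, hρ1, C, C, C, hC, hC, hC, 1, fun N hN => ?_⟩
    obtain ⟨v, hv, hres, hdec⟩ := H N hN
    refine ⟨v, hv, hres.trans ?_, fun _ j => (hdec j).trans ?_, fun h => absurd h hnot⟩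
    · gcongr
      exact le_max_left _ _
    · gcongr
      exact hscale hC hN
  · obtain ⟨ρ, C, hρ0, hρ1, hC, H⟩ := GaugeCapacitance.exists_right_quasimode
      (GaugeCapacitance.hasDecayingRoots_of_mem_lowerRegion hγ hlow)
    refine ⟨ρ, hρ0, hρ1, C, C, C, hC, hC, hC, 1, fun N hN => ?_⟩
    obtain ⟨v, hv, hres, hdec⟩ := H N hN
    refine ⟨v, hv, hres.trans ?_, fun h => absurd h hnot, fun _ j => (hdec j).trans ?_⟩
    · gcongr
      exact le_max_left _ _
    · gcongr
      exact hscale hC hN
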